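/- Let $(H,\rho)$ be a complete $\mathrm{CAT}(0)$ space with the geodesic extension property: for every $L>0$, every unit speed geodesic $[0,L]\to H$ is the restriction of an isometric embedding $\mathbb R\to H$. For $p\in H$ let $\tilde S_p$ be the set of normalized geodesics $\gamma:[0,1]\to H$ (of constant speed) with $\gamma(0)=p$; put $\zeta(\gamma)=0$ if $\gamma$ is constant and $\zeta(\gamma)=1$ otherwise. Let $\gamma_{p,q}$ be the normalized geodesic from $p$ to $q$. The Alexandrov angle of $\gamma_1,\gamma_2\in\tilde S_p$ is $\angle_p(\gamma_1,\gamma_2)=\lim_{s,t\to0^+}\overline\angle_p(\gamma_1(s),\gamma_2(t))$, where $\overline\angle_p(q,r)$ is the Euclidean comparison angle if $q,r\ne p$, $\overline\angle_p(p,p)=0$, and $\overline\angle_p(q,r)=\pi/2$ if exactly one of $q,r$ equals $p$. Let $S_p$ be the metric space obtained from $\tilde S_p$ by identifying geodesics at angle $0$. The tangent space $T_pH$ is the quotient of $[0,\infty)\times S_p$ by the relation: $(t_1,\gamma_1)\sim(t_2,\gamma_2)$ iff $t_1\zeta(\gamma_1)=t_2\zeta(\gamma_2)=0$, or $t_1\zeta(\gamma_1)=t_2\zeta(\gamma_2)>0$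 and $\gamma_1=\gamma_2$ in $S_p$. The class of $(t,\gamma)$ is written $t\gamma$, and $0_p:=0\gamma$. Put $$d_p(t_1\gamma_1,t_2\gamma_2)=\sqrt{t_1^2\zeta(\gamma_1)+t_2^2\zeta(\gamma_2)-2t_1t_2\zeta(\gamma_1)\zeta(\gamma_2)\cos\angle_p(\gamma_1,\gamma_2)},\qquad \|u\|_p=d_p(0_p,u),$$ $$g_p(u,v)=\tfrac12\big(\|u\|_p^2+\|v\|_p^2-d_p(u,v)^2\big).$$ Let $A$ be a set-valued vector field on $H$, that is, $Ap\subset T_pH$ for each $p\in H$, and let $\operatorname{dom}A=\{p: Ap\neq\emptyset\}$. Assume that $A$ is monotone, i.e. $g_p(\eta,\gamma_{p,q})\le -g_q(\nu,\gamma_{q,p})$ for all $p,q\in H$, $\eta\in Ap$, $\nu\in Aq$, and that $A$ satisfies the surjectivity condition: for all $t>0$ and $x\in H$ there is $p\in H$ with $t\rho(p,x)\gamma_{p,x}\in Ap$. For $\lambda>0$ let $J_\lambda x=\{z\in H:\lambda^{-1}\rho(z,x)\gamma_{z,x}\in Az\}$, and let $J_0$ be the identity. Write $|Ax|=\inf_{v\in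 Ax}\|v\|_x$, with $\inf\emptyset=+\infty$. Then every $J_\lambda$ is single-valued and defined on all of $H$, so that it is a map $H\to H$, and the following hold. 1. For every $x\in\overline{\operatorname{dom}A}$ and $t\in[0,\infty)$ the limit $S(t)x:=\lim_{k\to\infty}J_{t/k}^k x$ exists, and for each such $x$ the convergence is uniform in $t$ on every bounded subset (in particular every bounded subinterval) of $[0,\infty)$. 2. For every $x\in\operatorname{dom}A$, every $t\ge0$ and every integer $k\ge1$, $$\rho(J_{t/k}^k x,S(t)x)\le|Ax|\cdot\frac{2t}{\sqrt k}.$$ -/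

import Mathlib

open Set Filter Topology
open scoped NNReal ENNReal

noncomputable section

namespace CAT0

/-! Geodesics and spaces of nonpositive curvature -/

section Geodesics

variable {X : Type*} [MetricSpace X]

/-- The restriction of `c` to `[0, l]` is a geodesic of constant speed `K`
(values of `c` outside `[0, l]` are irrelevant). -/
def IsGeodesic (c : ℝ → X) (l K : ℝ) : Prop :=
  0 ≤ l ∧ 0 ≤ K ∧ ∀ s ∈ Icc 0 l, ∀ t ∈ Icc 0 l, dist (c s) (c t) = K * |s - t|

/-- A normalized geodesic, i.e. one parametrized by `[0, 1]`, from `x` to `y`. -/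
def IsNormalizedGeodesic (c : ℝ → X) (x y : X) : Prop :=
  (∃ K, IsGeodesic c 1 K) ∧ c 0 = x ∧ c 1 = y

end Geodesics

/-- Any two points are joined by a geodesic. -/
class GeodesicSpace (X : Type*) [MetricSpace X] : Prop where
  exists_geodesic : ∀ x y : X, ∃ (c : ℝ → X) (l K : ℝ), IsGeodesic c l K ∧ c 0 = x ∧ c l = y

/-- A `CAT(0)` space: a geodesic space in which every geodesic triangle with vertices `v 0`, `v 1`,
`v 2` and sides `c i` from `v i` to `v (i + 1)` (indices modulo `3`) is at least as thin as its
comparison triangle in the Euclidean plane. -/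
class CAT0Space (X : Type*) [MetricSpace X] : Prop extends GeodesicSpace X where
  cat0_inequality : ∀ (v : Fin 3 → X) (c : Fin 3 → ℝ → X),
    (∀ i, IsNormalizedGeodesic (c i) (v i) (v (i + 1))) →
    ∀ V : Fin 3 → EuclideanSpace ℝ (Fin 2), (∀ i j, dist (V i) (V j) = dist (v i) (v j)) →
    ∀ i j, ∀ x ∈ c i '' Icc 0 1, ∀ y ∈ c j '' Icc 0 1,
    ∀ x' ∈ segment ℝ (V i) (V (i + 1)), ∀ y' ∈ segment ℝ (V j) (V (j + 1)),
    dist (V i) x' = dist (v i) x → dist (V j) y' = dist (v j) y → dist x y ≤ dist x' y'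

/-- Every nondegenerate geodesic segment extends to a geodesic line. -/
def GeodesicExtensionProperty (X : Type*) [MetricSpace X] : Prop :=
  ∀ (c : ℝ → X) (L : ℝ), 0 < L → IsGeodesic c L 1 →
    ∃ η : ℝ → X, Isometry η ∧ ∀ t ∈ Icc 0 L, η t = c t

section Triangles

variable {X : Type*} [MetricSpace X]

open Classical in
/-- The comparison angle at `p` between `q` and `r`: the angle at the vertex corresponding to `p` of
a Euclidean triangle with side lengths `d(p,q)`, `d(p,r)`, `d(q,r)`, given by the law of cosines. -/
def comparisonAngle (p q r : X) : ℝ :=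
  if q = p then (if r = p then 0 else Real.pi / 2)
  else if r = p then Real.pi / 2
  else Real.arccos ((dist p q ^ 2 + dist p r ^ 2 - dist q r ^ 2) / (2 * dist p q * dist p r))

/-- The normalized geodesics issuing from `p`. -/
structure GeodesicFrom (p : X) where
  toFun : ℝ → X
  source : toFun 0 = p
  isGeodesic : ∃ K, IsGeodesic toFun 1 K

instance (p : X) : CoeFun (GeodesicFrom p) (fun _ => ℝ → X) := ⟨GeodesicFrom.toFun⟩

/-- The Alexandrov angle between two geodesics issuing from `p`. -/
def alexandrovAngle {p : X} (γ₁ γ₂ : GeodesicFrom p) : ℝ :=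
  limUnder (𝓝[>] (0 : ℝ) ×ˢ 𝓝[>] (0 : ℝ)) (fun a => comparisonAngle p (γ₁ a.1) (γ₂ a.2))

/-- The constant geodesic at `p`. -/
def zeroGeodesic (p : X) : GeodesicFrom p where
  toFun := fun _ => p
  source := rfl
  isGeodesic := ⟨0, zero_le_one, le_rfl, by simp⟩

open Classical in
/-- The indicator of nonzero geodesics. -/
def zetaFrom {p : X} (γ : GeodesicFrom p) : ℝ := if γ 1 = p then 0 else 1

/-! ### The Alexandrov angle exists in `CAT(0)` spaces and induces an equivalence relation -/

theorem GeodesicFrom.dist_eq {p : X} (γ : GeodesicFrom p) {s t : ℝ} (hs : s ∈ Icc (0 : ℝ) 1)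
    (ht : t ∈ Icc (0 : ℝ) 1) : dist (γ s) (γ t) = dist p (γ 1) * |s - t| := by
  obtain ⟨K, -, -, h⟩ := γ.isGeodesic
  have h1 := h 0 (by simp) 1 (by simp)
  rw [γ.source] at h1
  rw [h s hs t ht, h1]
  simp

theorem GeodesicFrom.dist_source {p : X} (γ : GeodesicFrom p) {s : ℝ} (hs : s ∈ Icc (0 : ℝ) 1) :
    dist p (γ s) = dist p (γ 1) * s := by
  have := γ.dist_eq (s := 0) (t := s) (by simp) hs
  rw [γ.source] at this
  rw [this]
  simp [abs_of_nonneg hs.1]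

theorem GeodesicFrom.eq_source_iff {p : X} (γ : GeodesicFrom p) {s : ℝ} (hs0 : 0 < s) (hs1 : s ≤ 1) :
    γ s = p ↔ γ 1 = p := by
  have h := γ.dist_source ⟨hs0.le, hs1⟩
  constructor
  · intro h1
    rw [h1, dist_self] at h
    rcases mul_eq_zero.1 h.symm with h2 | h2
    · exact (dist_eq_zero.1 h2).symm
    · exact absurd h2 hs0.ne'
  · intro h1
    rw [h1, dist_self, zero_mul] at h
    exact (dist_eq_zero.1 h).symm

theorem exists_comparisonTriangle (p q r : X) : ∃ P Q R : EuclideanSpace ℝ (Fin 2),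
    dist P Q = dist p q ∧ dist P R = dist p r ∧ dist Q R = dist q r := by
  rcases eq_or_ne p q with rfl | hpq
  · refine ⟨0, 0, !₂[dist p r, 0], ?_, ?_, ?_⟩ <;>
      simp [EuclideanSpace.dist_eq, Fin.sum_univ_two]
  · have ha : 0 < dist p q := dist_pos.2 hpq
    set a := dist p q with ha'
    set b := dist p r with hb'
    set c := dist q r with hc'
    have hb : 0 ≤ b := dist_nonneg
    have hc : 0 ≤ c := dist_nonneg
    have h1 : a ≤ b + c := by
      have := dist_triangle p r q; rw [dist_comm r q] at this; exact this
    have h2 : b ≤ a + c := dist_triangle p q r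
    have h3 : c ≤ a + b := by
      have := dist_triangle q p r; rw [dist_comm q p] at this; exact this
    set x := (a ^ 2 + b ^ 2 - c ^ 2) / (2 * a) with hx
    have hxa : x * (2 * a) = a ^ 2 + b ^ 2 - c ^ 2 := by rw [hx]; field_simp
    have hy : 0 ≤ b ^ 2 - x ^ 2 := by
      have e1 : 0 ≤ (b - x) := by
        by_contra hcon
        push Not at hcon
        nlinarith
      have e2 : 0 ≤ (b + x) := by
        by_contra hcon
        push Not at hcon
        nlinarith
      nlinarith
    refine ⟨0, !₂[a, 0], !₂[x, Real.sqrt (b ^ 2 - x ^ 2)], ?_, ?_, ?_⟩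
    · simp [EuclideanSpace.dist_eq, Fin.sum_univ_two, Real.sqrt_sq ha.le]
    · simp [EuclideanSpace.dist_eq, Fin.sum_univ_two, Real.sq_sqrt hy, Real.sqrt_sq hb]
    · simp only [EuclideanSpace.dist_eq, Fin.sum_univ_two, Real.dist_eq, sq_abs]
      simp only [Matrix.cons_val_zero, Matrix.cons_val_one, zero_sub, neg_sq,
        Matrix.cons_val_fin_one, Real.sq_sqrt hy]
      rw [show (a - x) ^ 2 + (b ^ 2 - x ^ 2) = c ^ 2 by nlinarith, Real.sqrt_sq hc]

theorem comparisonAngle_comm (p q r : X) : comparisonAngle p q r = comparisonAngle p r q := by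
  unfold comparisonAngle
  split_ifs <;> try rfl
  rw [dist_comm q r]
  congr 1
  ring

theorem comparisonAngle_nonneg (p q r : X) : 0 ≤ comparisonAngle p q r := by
  unfold comparisonAngle
  split_ifs
  · exact le_rfl
  · positivity
  · positivity
  · exact Real.arccos_nonneg _

theorem comparisonAngle_le_pi (p q r : X) : comparisonAngle p q r ≤ Real.pi := by
  have := Real.pi_pos
  unfold comparisonAngle
  split_ifs
  · linarith
  · linarith
  · linarith
  · exact Real.arccos_le_pi _

/-- The law of cosines for the comparison angle. -/
theorem dist_sq_eq_comparisonAngle {p q r : X} (hq : q ≠ p) (hr : r ≠ p) :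
    dist q r ^ 2 = dist p q ^ 2 + dist p r ^ 2
      - 2 * dist p q * dist p r * Real.cos (comparisonAngle p q r) := by
  have ha : 0 < dist p q := dist_pos.2 hq.symm
  have hb : 0 < dist p r := dist_pos.2 hr.symm
  have h1 : dist p q ≤ dist p r + dist q r := by
    have := dist_triangle p r q; rw [dist_comm r q] at this; exact this
  have h2 : dist p r ≤ dist p q + dist q r := dist_triangle p q r
  have h3 : dist q r ≤ dist p q + dist p r := by
    have := dist_triangle q p r; rw [dist_comm q p] at this; exact this
  have hc : 0 ≤ dist q r := dist_nonneg
  have hab : 0 < 2 * dist p q * dist p r := by positivity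
  unfold comparisonAngle
  rw [if_neg hq, if_neg hr, Real.cos_arccos]
  · field_simp
    ring
  · rw [le_div_iff₀ hab]; nlinarith
  · rw [div_le_iff₀ hab]
    nlinarith [mul_nonneg (sub_nonneg.2 h1) (sub_nonneg.2 h2)]

theorem cat0_vertex [CAT0Space X] {p : X} (γ : GeodesicFrom p) (r : X) {s : ℝ}
    (hs : s ∈ Icc (0 : ℝ) 1) :
    dist (γ s) r ^ 2 ≤ (1 - s) * dist p r ^ 2 + s * dist (γ 1) r ^ 2
      - s * (1 - s) * dist p (γ 1) ^ 2 := by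
  have norm_geo : ∀ x y : X, ∃ c : ℝ → X, IsNormalizedGeodesic c x y := by
    intro x y
    obtain ⟨c, l, K, ⟨hl, hK, hc⟩, h0, h1⟩ := GeodesicSpace.exists_geodesic x y
    refine ⟨fun t => c (l * t), ⟨K * l, zero_le_one, by positivity, ?_⟩, by simpa, by simpa⟩
    intro s hs t ht
    have := hc (l * s) ⟨by nlinarith [hs.1], by nlinarith [hs.2]⟩ (l * t)
      ⟨by nlinarith [ht.1], by nlinarith [ht.2]⟩
    rw [this, ← mul_sub, abs_mul, abs_of_nonneg hl, mul_assoc]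
  obtain ⟨c₁, h₁⟩ := norm_geo (γ 1) r
  obtain ⟨c₂, h₂⟩ := norm_geo r p
  obtain ⟨P, Q, R, hPQ, hPR, hQR⟩ := exists_comparisonTriangle p (γ 1) r
  have key := CAT0Space.cat0_inequality ![p, γ 1, r] ![γ.toFun, c₁, c₂] (by
      intro i
      fin_cases i
      · exact ⟨γ.isGeodesic, γ.source, rfl⟩
      · exact h₁
      · exact h₂) ![P, Q, R] (by
      intro i j
      fin_cases i <;> fin_cases j <;> simp [hPQ, hPR, hQR, dist_comm Q P, dist_comm R P,
        dist_comm R Q, dist_comm (γ 1) p, dist_comm r p, dist_comm r (γ 1)])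
    0 2 (γ s) ⟨s, hs, rfl⟩ r ⟨0, by simp, h₂.2.1⟩ (AffineMap.lineMap P Q s)
    (by
      rw [segment_eq_image_lineMap]
      exact ⟨s, hs, rfl⟩) R (left_mem_segment ℝ R P)
    (by
      simp only [Matrix.cons_val_zero]
      rw [γ.dist_source hs, dist_left_lineMap, hPQ, Real.norm_of_nonneg hs.1, mul_comm])
    (by simp)
  have e : dist (AffineMap.lineMap P Q s) R ^ 2 =
      (1 - s) * dist P R ^ 2 + s * dist Q R ^ 2 - s * (1 - s) * dist P Q ^ 2 := by
    have e1 : dist (AffineMap.lineMap P Q s) R = ‖s • (Q - P) - (R - P)‖ := by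
      rw [dist_eq_norm, AffineMap.lineMap_apply_module']
      congr 1
      abel
    have e2 : dist P R = ‖R - P‖ := by rw [dist_comm, dist_eq_norm]
    have e3 : dist P Q = ‖Q - P‖ := by rw [dist_comm, dist_eq_norm]
    have e4 : dist Q R = ‖(Q - P) - (R - P)‖ := by
      rw [dist_eq_norm]; congr 1; abel
    rw [e1, e2, e3, e4, norm_sub_sq_real (s • (Q - P)), norm_sub_sq_real (Q - P), norm_smul, inner_smul_left]
    simp only [Real.norm_eq_abs, mul_pow, sq_abs, conj_trivial]
    ring
  rw [hPR, hQR, hPQ] at e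
  rw [← e]
  exact pow_le_pow_left₀ dist_nonneg key 2

theorem comparisonAngle_mono_left [CAT0Space X] {p : X} (γ : GeodesicFrom p) (r : X) {s' s : ℝ}
    (hs' : 0 < s') (hss : s' ≤ s) (hs : s ≤ 1) :
    comparisonAngle p (γ s') r ≤ comparisonAngle p (γ s) r := by
  have hs0 : 0 < s := hs'.trans_le hss
  by_cases h1 : γ 1 = p
  · rw [(γ.eq_source_iff hs' (hss.trans hs)).2 h1, (γ.eq_source_iff hs0 hs).2 h1]
  have a1 : γ s' ≠ p := fun h => h1 ((γ.eq_source_iff hs' (hss.trans hs)).1 h)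
  have a2 : γ s ≠ p := fun h => h1 ((γ.eq_source_iff hs0 hs).1 h)
  by_cases hr : r = p
  · simp [comparisonAngle, a1, a2, hr]
  unfold comparisonAngle
  rw [if_neg a1, if_neg a2, if_neg hr, if_neg hr]
  apply Real.arccos_le_arccos
  have hD : 0 < dist p (γ 1) := dist_pos.2 (Ne.symm h1)
  have hr' : 0 < dist p r := dist_pos.2 (Ne.symm hr)
  -- the subgeodesic up to parameter `s`
  let δ : GeodesicFrom p :=
    { toFun := fun t => γ (s * t)
      source := by simpa using γ.source
      isGeodesic := by
        refine ⟨dist p (γ 1) * s, zero_le_one, by positivity, ?_⟩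
        intro x hx y hy
        rw [γ.dist_eq ⟨by nlinarith [hx.1], by nlinarith [hx.2]⟩
          ⟨by nlinarith [hy.1], by nlinarith [hy.2]⟩, ← mul_sub, abs_mul, abs_of_pos hs0,
          mul_assoc] }
  have hv := cat0_vertex δ r (s := s' / s) ⟨by positivity, by rwa [div_le_one hs0]⟩
  have d1 : δ (s' / s) = γ s' := by
    change γ (s * (s' / s)) = γ s'
    congr 1
    field_simp
  have d2 : δ 1 = γ s := by
    change γ (s * 1) = γ s
    rw [mul_one]
  rw [d1, d2, γ.dist_source ⟨hs0.le, hs⟩] at hv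
  rw [γ.dist_source ⟨hs0.le, hs⟩, γ.dist_source ⟨hs'.le, hss.trans hs⟩,
    div_le_div_iff₀ (by positivity) (by positivity)]
  set D := dist p (γ 1)
  set b := dist p r
  set C := dist (γ s) r
  set C' := dist (γ s') r
  have hv2 : s * C' ^ 2 ≤ (s - s') * b ^ 2 + s' * C ^ 2 - s' * (s - s') * s * D ^ 2 := by
    have := mul_le_mul_of_nonneg_left hv hs0.le
    have e : s * ((1 - s' / s) * b ^ 2 + s' / s * C ^ 2 - s' / s * (1 - s' / s) * (D * s) ^ 2)
        = (s - s') * b ^ 2 + s' * C ^ 2 - s' * (s - s') * s * D ^ 2 := by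
      field_simp
    rwa [e] at this
  have hDb : 0 ≤ 2 * D * b := by positivity
  nlinarith [mul_le_mul_of_nonneg_left hv2 hDb]

theorem comparisonAngle_mono [CAT0Space X] {p : X} (γ₁ γ₂ : GeodesicFrom p) {s' s t' t : ℝ}
    (hs' : 0 < s') (hss : s' ≤ s) (hs : s ≤ 1) (ht' : 0 < t') (htt : t' ≤ t) (ht : t ≤ 1) :
    comparisonAngle p (γ₁ s') (γ₂ t') ≤ comparisonAngle p (γ₁ s) (γ₂ t) := by
  refine (comparisonAngle_mono_left γ₁ (γ₂ t') hs' hss hs).trans ?_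
  rw [comparisonAngle_comm p (γ₁ s), comparisonAngle_comm p (γ₁ s)]
  exact comparisonAngle_mono_left γ₂ (γ₁ s) ht' htt ht

/-- In a `CAT(0)` space the limit that defines the Alexandrov angle exists. -/
theorem tendsto_alexandrovAngle [CAT0Space X] {p : X} (γ₁ γ₂ : GeodesicFrom p) :
    Tendsto (fun a : ℝ × ℝ => comparisonAngle p (γ₁ a.1) (γ₂ a.2))
      (𝓝[>] (0 : ℝ) ×ˢ 𝓝[>] (0 : ℝ)) (𝓝 (alexandrovAngle γ₁ γ₂)) := by
  apply tendsto_nhds_limUnder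
  let f : ℝ × ℝ → ℝ := fun a => comparisonAngle p (γ₁ a.1) (γ₂ a.2)
  let B : Set ℝ := f '' (Ioc (0 : ℝ) 1 ×ˢ Ioc (0 : ℝ) 1)
  have hB : BddBelow B := ⟨0, by rintro _ ⟨a, -, rfl⟩; exact comparisonAngle_nonneg _ _ _⟩
  have hne : B.Nonempty := ⟨_, (1, 1), by simp, rfl⟩
  refine ⟨sInf B, Metric.tendsto_nhds.2 fun ε hε => ?_⟩
  obtain ⟨_, ⟨⟨s, t⟩, ⟨hs, ht⟩, rfl⟩, hlt⟩ := exists_lt_of_csInf_lt hne (lt_add_of_pos_right _ hε)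
  have hm : Ioo (0 : ℝ) s ×ˢ Ioo (0 : ℝ) t ∈ 𝓝[>] (0 : ℝ) ×ˢ 𝓝[>] (0 : ℝ) :=
    prod_mem_prod (Ioo_mem_nhdsGT hs.1) (Ioo_mem_nhdsGT ht.1)
  filter_upwards [hm] with a ha
  have l1 : sInf B ≤ f a := csInf_le hB ⟨a, ⟨⟨ha.1.1, ha.1.2.le.trans hs.2⟩,
    ⟨ha.2.1, ha.2.2.le.trans ht.2⟩⟩, rfl⟩
  have l2 : f a ≤ f (s, t) :=
    comparisonAngle_mono γ₁ γ₂ ha.1.1 ha.1.2.le hs.2 ha.2.1 ha.2.2.le ht.2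
  rw [Real.dist_eq, abs_lt]
  constructor <;> linarith

theorem alexandrovAngle_comm [CAT0Space X] {p : X} (γ₁ γ₂ : GeodesicFrom p) :
    alexandrovAngle γ₁ γ₂ = alexandrovAngle γ₂ γ₁ := by
  refine tendsto_nhds_unique (tendsto_alexandrovAngle γ₁ γ₂) ?_
  refine ((tendsto_alexandrovAngle γ₂ γ₁).comp Filter.tendsto_prod_swap).congr fun a => ?_
  exact comparisonAngle_comm _ _ _

theorem alexandrovAngle_mem [CAT0Space X] {p : X} (γ₁ γ₂ : GeodesicFrom p) :
    alexandrovAngle γ₁ γ₂ ∈ Icc 0 Real.pi :=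
  ⟨ge_of_tendsto' (tendsto_alexandrovAngle γ₁ γ₂) fun _ => comparisonAngle_nonneg _ _ _,
    le_of_tendsto' (tendsto_alexandrovAngle γ₁ γ₂) fun _ => comparisonAngle_le_pi _ _ _⟩

theorem alexandrovAngle_eq_of_eventually [CAT0Space X] {p : X} {γ₁ γ₂ : GeodesicFrom p} {θ : ℝ}
    (h : ∀ s ∈ Ioc (0 : ℝ) 1, ∀ t ∈ Ioc (0 : ℝ) 1, comparisonAngle p (γ₁ s) (γ₂ t) = θ) :
    alexandrovAngle γ₁ γ₂ = θ := by
  refine tendsto_nhds_unique (tendsto_alexandrovAngle γ₁ γ₂) ?_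
  refine tendsto_const_nhds.congr' ?_
  have hm : Ioc (0 : ℝ) 1 ×ˢ Ioc (0 : ℝ) 1 ∈ 𝓝[>] (0 : ℝ) ×ˢ 𝓝[>] (0 : ℝ) :=
    prod_mem_prod (Ioc_mem_nhdsGT one_pos) (Ioc_mem_nhdsGT one_pos)
  filter_upwards [hm] with a ha
  exact (h _ ha.1 _ ha.2).symm

theorem alexandrovAngle_zero_zero [CAT0Space X] {p : X} {γ₁ γ₂ : GeodesicFrom p}
    (h₁ : γ₁ 1 = p) (h₂ : γ₂ 1 = p) : alexandrovAngle γ₁ γ₂ = 0 :=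
  alexandrovAngle_eq_of_eventually fun s hs t ht => by
    simp [comparisonAngle, (γ₁.eq_source_iff hs.1 hs.2).2 h₁, (γ₂.eq_source_iff ht.1 ht.2).2 h₂]

theorem alexandrovAngle_zero_left [CAT0Space X] {p : X} {γ₁ γ₂ : GeodesicFrom p}
    (h₁ : γ₁ 1 = p) (h₂ : γ₂ 1 ≠ p) : alexandrovAngle γ₁ γ₂ = Real.pi / 2 :=
  alexandrovAngle_eq_of_eventually fun s hs t ht => by
    have h : γ₂ t ≠ p := fun h => h₂ ((γ₂.eq_source_iff ht.1 ht.2).1 h)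
    simp [comparisonAngle, (γ₁.eq_source_iff hs.1 hs.2).2 h₁, h]

theorem alexandrovAngle_self [CAT0Space X] {p : X} (γ : GeodesicFrom p) :
    alexandrovAngle γ γ = 0 := by
  by_cases h : γ 1 = p
  · exact alexandrovAngle_zero_zero h h
  refine alexandrovAngle_eq_of_eventually fun s hs t ht => ?_
  have hs' : γ s ≠ p := fun e => h ((γ.eq_source_iff hs.1 hs.2).1 e)
  have ht' : γ t ≠ p := fun e => h ((γ.eq_source_iff ht.1 ht.2).1 e)
  have hD : 0 < dist p (γ 1) := dist_pos.2 (Ne.symm h)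
  have := hs.1
  have := ht.1
  unfold comparisonAngle
  rw [if_neg hs', if_neg ht', γ.dist_source ⟨hs.1.le, hs.2⟩, γ.dist_source ⟨ht.1.le, ht.2⟩,
    γ.dist_eq ⟨hs.1.le, hs.2⟩ ⟨ht.1.le, ht.2⟩, mul_pow _ |s - t|, sq_abs]
  have : ((dist p (γ 1) * s) ^ 2 + (dist p (γ 1) * t) ^ 2 - dist p (γ 1) ^ 2 * (s - t) ^ 2) /
      (2 * (dist p (γ 1) * s) * (dist p (γ 1) * t)) = 1 := by
    field_simp
    ring
  rw [this, Real.arccos_one]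

/-- For nonzero geodesics with lengths `a₁, a₂` the Alexandrov angle is computed along points at
equal distance `ε` from the source. -/
theorem tendsto_chord [CAT0Space X] {p : X} {γ₁ γ₂ : GeodesicFrom p} (h₁ : γ₁ 1 ≠ p)
    (h₂ : γ₂ 1 ≠ p) :
    Tendsto (fun ε : ℝ => dist (γ₁ (ε / dist p (γ₁ 1))) (γ₂ (ε / dist p (γ₂ 1))) / ε) (𝓝[>] 0)
      (𝓝 (Real.sqrt (2 * (1 - Real.cos (alexandrovAngle γ₁ γ₂))))) := by
  have ha : 0 < dist p (γ₁ 1) := dist_pos.2 (Ne.symm h₁)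
  have hb : 0 < dist p (γ₂ 1) := dist_pos.2 (Ne.symm h₂)
  have aux : ∀ {a : ℝ}, 0 < a → Tendsto (fun ε : ℝ => ε / a) (𝓝[>] 0) (𝓝[>] 0) := by
    intro a ha
    refine tendsto_nhdsWithin_iff.2 ⟨?_, ?_⟩
    · have : Tendsto (fun ε : ℝ => ε / a) (𝓝 0) (𝓝 (0 / a)) := tendsto_id.div_const a
      rw [zero_div] at this
      exact this.mono_left nhdsWithin_le_nhds
    · filter_upwards [self_mem_nhdsWithin] with ε hε
      exact div_pos hε ha
  have hcomp := (tendsto_alexandrovAngle γ₁ γ₂).comp ((aux ha).prodMk (aux hb))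
  have hlim := (((Real.continuous_cos.tendsto _).comp hcomp).const_sub 1).const_mul 2
  refine ((Real.continuous_sqrt.tendsto _).comp hlim).congr' ?_
  filter_upwards [Ioc_mem_nhdsGT ha, Ioc_mem_nhdsGT hb] with ε hε1 hε2
  have m1 : ε / dist p (γ₁ 1) ∈ Icc (0 : ℝ) 1 :=
    ⟨(div_pos hε1.1 ha).le, (div_le_one ha).2 hε1.2⟩
  have m2 : ε / dist p (γ₂ 1) ∈ Icc (0 : ℝ) 1 :=
    ⟨(div_pos hε1.1 hb).le, (div_le_one hb).2 hε2.2⟩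
  have n1 : γ₁ (ε / dist p (γ₁ 1)) ≠ p :=
    fun e => h₁ ((γ₁.eq_source_iff (div_pos hε1.1 ha) m1.2).1 e)
  have n2 : γ₂ (ε / dist p (γ₂ 1)) ≠ p :=
    fun e => h₂ ((γ₂.eq_source_iff (div_pos hε1.1 hb) m2.2).1 e)
  have law := dist_sq_eq_comparisonAngle n1 n2
  rw [γ₁.dist_source m1, γ₂.dist_source m2, mul_div_cancel₀ _ ha.ne', mul_div_cancel₀ _ hb.ne']
    at law
  simp only [Function.comp_apply]
  have hε : ε ≠ 0 := hε1.1.ne'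
  have e : 2 * (1 - Real.cos (comparisonAngle p (γ₁ (ε / dist p (γ₁ 1)))
      (γ₂ (ε / dist p (γ₂ 1))))) =
      (dist (γ₁ (ε / dist p (γ₁ 1))) (γ₂ (ε / dist p (γ₂ 1))) / ε) ^ 2 := by
    rw [div_pow, law]
    field_simp
    ring
  rw [e, Real.sqrt_sq (div_nonneg dist_nonneg hε1.1.le)]

theorem chord_triangle [CAT0Space X] {p : X} {γ₁ γ₂ γ₃ : GeodesicFrom p} (h₁ : γ₁ 1 ≠ p)
    (h₂ : γ₂ 1 ≠ p) (h₃ : γ₃ 1 ≠ p) :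
    Real.sqrt (2 * (1 - Real.cos (alexandrovAngle γ₁ γ₃))) ≤
      Real.sqrt (2 * (1 - Real.cos (alexandrovAngle γ₁ γ₂))) +
      Real.sqrt (2 * (1 - Real.cos (alexandrovAngle γ₂ γ₃))) := by
  refine le_of_tendsto_of_tendsto (tendsto_chord h₁ h₃)
    ((tendsto_chord h₁ h₂).add (tendsto_chord h₂ h₃)) ?_
  filter_upwards [self_mem_nhdsWithin] with ε hε
  have hε' : (0 : ℝ) < ε := hε
  rw [← add_div]
  gcongr
  exact dist_triangle _ _ _

/-- Geodesics at angle zero are both zero or both nonzero. -/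
theorem zero_iff_of_angle_eq_zero [CAT0Space X] {p : X} {γ₁ γ₂ : GeodesicFrom p}
    (h : alexandrovAngle γ₁ γ₂ = 0) : γ₁ 1 = p ↔ γ₂ 1 = p := by
  have hpi := Real.pi_pos
  constructor
  · intro h₁
    by_contra h₂
    rw [alexandrovAngle_zero_left h₁ h₂] at h
    linarith
  · intro h₂
    by_contra h₁
    rw [alexandrovAngle_comm, alexandrovAngle_zero_left h₂ h₁] at h
    linarith

/-- The Alexandrov angle does not distinguish geodesics at angle zero. -/
theorem alexandrovAngle_congr_left [CAT0Space X] {p : X} {γ₁ γ₂ : GeodesicFrom p}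
    (h : alexandrovAngle γ₁ γ₂ = 0) (δ : GeodesicFrom p) :
    alexandrovAngle γ₁ δ = alexandrovAngle γ₂ δ := by
  have hz := zero_iff_of_angle_eq_zero h
  by_cases h₁ : γ₁ 1 = p
  · by_cases hδ : δ 1 = p
    · rw [alexandrovAngle_zero_zero h₁ hδ, alexandrovAngle_zero_zero (hz.1 h₁) hδ]
    · rw [alexandrovAngle_zero_left h₁ hδ, alexandrovAngle_zero_left (hz.1 h₁) hδ]
  · have h₂ : γ₂ 1 ≠ p := fun e => h₁ (hz.2 e)
    by_cases hδ : δ 1 = p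
    · rw [alexandrovAngle_comm γ₁, alexandrovAngle_comm γ₂, alexandrovAngle_zero_left hδ h₁,
        alexandrovAngle_zero_left hδ h₂]
    · have t1 := chord_triangle h₁ h₂ hδ
      have t2 := chord_triangle h₂ h₁ hδ
      rw [alexandrovAngle_comm γ₂ γ₁] at t2
      rw [h, Real.cos_zero, sub_self, mul_zero, Real.sqrt_zero, zero_add] at t1 t2
      have t := le_antisymm t1 t2
      rw [Real.sqrt_inj (by linarith [Real.cos_le_one (alexandrovAngle γ₁ δ)])
        (by linarith [Real.cos_le_one (alexandrovAngle γ₂ δ)])] at t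
      exact Real.injOn_cos (alexandrovAngle_mem _ _) (alexandrovAngle_mem _ _) (by linarith)

end Triangles

/-! Tangent spaces -/

section Tangent

variable {H : Type*} [MetricSpace H] [CAT0Space H]

/-- Geodesics issuing from `p` are identified when their Alexandrov angle is zero. -/
instance directionSetoid (p : H) : Setoid (GeodesicFrom p) where
  r := fun γ₁ γ₂ => alexandrovAngle γ₁ γ₂ = 0
  iseqv :=
    { refl := alexandrovAngle_self
      symm := fun {γ₁ γ₂} h => (alexandrovAngle_comm γ₂ γ₁).trans h
      trans := fun {_ _ γ₃} h₁ h₂ => (alexandrovAngle_congr_left h₁ γ₃).trans h₂ }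

/-- The space of directions `S_p`. -/
def Direction (p : H) : Type _ := Quotient (directionSetoid p)

/-- The angle between two directions at `p`. -/
def Direction.angle {p : H} : Direction p → Direction p → ℝ :=
  Quotient.lift₂ alexandrovAngle (fun γ₁ γ₂ δ₁ δ₂ h₁ h₂ => by
    have h₁' : alexandrovAngle γ₁ δ₁ = 0 := h₁
    have h₂' : alexandrovAngle γ₂ δ₂ = 0 := h₂
    rw [alexandrovAngle_congr_left h₁', alexandrovAngle_comm δ₁, alexandrovAngle_congr_left h₂',
      alexandrovAngle_comm])

/-- The indicator `ζ` of the nonzero directions. -/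
def Direction.zeta {p : H} : Direction p → ℝ :=
  Quotient.lift zetaFrom (fun γ₁ γ₂ h => by
    have h' := zero_iff_of_angle_eq_zero (show alexandrovAngle γ₁ γ₂ = 0 from h)
    unfold zetaFrom
    split_ifs <;> tauto)

theorem Direction.zeta_eq {p : H} (γ : Direction p) : γ.zeta = 0 ∨ γ.zeta = 1 := by
  obtain ⟨δ, rfl⟩ := Quotient.exists_rep γ
  change zetaFrom δ = 0 ∨ zetaFrom δ = 1
  unfold zetaFrom
  split_ifs
  · exact Or.inl rfl
  · exact Or.inr rfl

/-- The pairs `(t₁, γ₁)` and `(t₂, γ₂)` represent the same tangent vector. -/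
instance tangentSetoid (p : H) : Setoid (ℝ≥0 × Direction p) where
  r := fun u v => ((u.1 : ℝ) * u.2.zeta = 0 ∧ (v.1 : ℝ) * v.2.zeta = 0) ∨
    ((u.1 : ℝ) * u.2.zeta = v.1 * v.2.zeta ∧ 0 < (u.1 : ℝ) * u.2.zeta ∧ u.2 = v.2)
  iseqv :=
    { refl := fun u => by
        rcases eq_or_ne ((u.1 : ℝ) * u.2.zeta) 0 with h | h
        · exact Or.inl ⟨h, h⟩
        · refine Or.inr ⟨rfl, lt_of_le_of_ne (mul_nonneg u.1.2 ?_) h.symm, rfl⟩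
          rcases u.2.zeta_eq with h' | h' <;> simp [h']
      symm := by
        rintro u v (⟨h1, h2⟩ | ⟨h1, h2, h3⟩)
        · exact Or.inl ⟨h2, h1⟩
        · exact Or.inr ⟨h1.symm, h1 ▸ h2, h3.symm⟩
      trans := by
        rintro u v w (⟨h1, h2⟩ | ⟨h1, h2, h3⟩) (⟨h4, h5⟩ | ⟨h4, h5, h6⟩)
        · exact Or.inl ⟨h1, h5⟩
        · exact absurd h2 h5.ne'
        · exact absurd (h1.trans h4) h2.ne'
        · exact Or.inr ⟨h1.trans h4, h2, h3.trans h6⟩ }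

/-- The tangent space (tangent cone) `T_p H` of `H` at `p`. -/
def TangentCone (p : H) : Type _ := Quotient (tangentSetoid p)

namespace TangentCone

/-- The tangent vector `t γ`. -/
def mk {p : H} (t : ℝ≥0) (γ : GeodesicFrom p) : TangentCone p :=
  Quotient.mk (tangentSetoid p) (t, Quotient.mk (directionSetoid p) γ)

/-- The metric `d_p` of the tangent space. -/
def distP {p : H} : TangentCone p → TangentCone p → ℝ :=
  Quotient.lift₂ (fun u v => Real.sqrt ((u.1 : ℝ) ^ 2 * u.2.zeta + (v.1 : ℝ) ^ 2 * v.2.zeta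
      - 2 * u.1 * v.1 * u.2.zeta * v.2.zeta * Real.cos (u.2.angle v.2))) (by
    have key : ∀ u v : ℝ≥0 × Direction p, (u.1 : ℝ) ^ 2 * u.2.zeta + (v.1 : ℝ) ^ 2 * v.2.zeta
        - 2 * u.1 * v.1 * u.2.zeta * v.2.zeta * Real.cos (u.2.angle v.2) =
        ((u.1 : ℝ) * u.2.zeta) ^ 2 + ((v.1 : ℝ) * v.2.zeta) ^ 2
        - 2 * ((u.1 : ℝ) * u.2.zeta) * ((v.1 : ℝ) * v.2.zeta) * Real.cos (u.2.angle v.2) := by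
      intro u v
      rcases u.2.zeta_eq with h | h <;> rcases v.2.zeta_eq with h' | h' <;> rw [h, h'] <;> ring
    intro u v u' v' h₁ h₂
    change ((u.1 : ℝ) * u.2.zeta = 0 ∧ (u'.1 : ℝ) * u'.2.zeta = 0) ∨
      ((u.1 : ℝ) * u.2.zeta = u'.1 * u'.2.zeta ∧ 0 < (u.1 : ℝ) * u.2.zeta ∧ u.2 = u'.2) at h₁
    change ((v.1 : ℝ) * v.2.zeta = 0 ∧ (v'.1 : ℝ) * v'.2.zeta = 0) ∨
      ((v.1 : ℝ) * v.2.zeta = v'.1 * v'.2.zeta ∧ 0 < (v.1 : ℝ) * v.2.zeta ∧ v.2 = v'.2) at h₂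
    simp only [key]
    congr 1
    rcases h₁ with ⟨a, b⟩ | ⟨a, -, b⟩ <;> rcases h₂ with ⟨c, d⟩ | ⟨c, -, d⟩
    · rw [a, b, c, d]; ring
    · rw [a, b, c]; ring
    · rw [a, c, d]; ring
    · rw [a, b, c, d])

/-- The zero vector `0_p`. -/
def zero (p : H) : TangentCone p := mk 0 (zeroGeodesic p)

/-- The norm `‖v‖_p = d_p(0_p, v)`. -/
def norm {p : H} (v : TangentCone p) : ℝ := distP (zero p) v

/-- The product `g_p`, the analogue of the inner product. -/
def g {p : H} (u v : TangentCone p) : ℝ := (norm u ^ 2 + norm v ^ 2 - distP u v ^ 2) / 2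

end TangentCone

theorem exists_normalizedGeodesic (x y : H) : ∃ γ : GeodesicFrom x, γ 1 = y := by
  obtain ⟨c, l, K, ⟨hl, hK, hc⟩, h0, h1⟩ := GeodesicSpace.exists_geodesic x y
  refine ⟨⟨fun t => c (l * t), by simpa, ⟨K * l, zero_le_one, by positivity, ?_⟩⟩, by simpa⟩
  intro s hs t ht
  have := hc (l * s) ⟨by nlinarith [hs.1], by nlinarith [hs.2]⟩ (l * t)
    ⟨by nlinarith [ht.1], by nlinarith [ht.2]⟩
  rw [this, ← mul_sub, abs_mul, abs_of_nonneg hl, mul_assoc]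

/-- The normalized geodesic `γ_{x,y}` from `x` to `y` (it is unique on `[0, 1]`). -/
def geodesic (x y : H) : GeodesicFrom x := (exists_normalizedGeodesic x y).choose

theorem geodesic_one (x y : H) : geodesic x y 1 = y := (exists_normalizedGeodesic x y).choose_spec

end Tangent

/-! Vector fields -/

/-- A set-valued vector field on `H`. -/
def VectorField (H : Type*) [MetricSpace H] [CAT0Space H] : Type _ :=
  ∀ p : H, Set (TangentCone p)

namespace VectorField

variable {H : Type*} [MetricSpace H] [CAT0Space H]

/-- The domain of `A`: the points with nonempty value. -/
def dom (A : VectorField H) : Set H := {p | (A p).Nonempty}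

/-- Monotonicity of a vector field. -/
def IsMonotone (A : VectorField H) : Prop :=
  ∀ p q : H, ∀ η ∈ A p, ∀ ν ∈ A q,
    TangentCone.g η (TangentCone.mk 1 (geodesic p q)) ≤
      -TangentCone.g ν (TangentCone.mk 1 (geodesic q p))

/-- The surjectivity condition. -/
def SurjectivityCondition (A : VectorField H) : Prop :=
  ∀ t : ℝ≥0, 0 < t → ∀ x : H, ∃ p : H, TangentCone.mk (t * nndist p x) (geodesic p x) ∈ A p

/-- The quantity `|Ax|`, the infimum of the norms of the elements of `Ax`, with `inf ∅ = ∞`. -/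
def absAt (A : VectorField H) (x : H) : ℝ≥0∞ :=
  ⨅ v ∈ A x, ENNReal.ofReal (TangentCone.norm v)

/-- The set-valued resolvent `J_lam`; `J_0` is the identity. -/
def resolventSet (A : VectorField H) (lam : ℝ≥0) (x : H) : Set H :=
  if lam = 0 then {x} else {z | TangentCone.mk (lam⁻¹ * nndist z x) (geodesic z x) ∈ A z}

open Classical in
/-- The resolvent `J_lam` as a map: the element of `resolventSet A lam x`, which is a singleton for a
monotone vector field with the surjectivity condition. -/
def resolvent (A : VectorField H) (lam : ℝ≥0) (x : H) : H :=
  if h : (resolventSet A lam x).Nonempty then h.choose else x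

end VectorField

end CAT0

end

open CAT0

namespace CAT0

section Geometry

variable {X : Type*} [MetricSpace X] [CAT0Space X]

theorem alexandrovAngle_le_comparisonAngle {p : X} (γ₁ γ₂ : GeodesicFrom p) :
    alexandrovAngle γ₁ γ₂ ≤ comparisonAngle p (γ₁ 1) (γ₂ 1) := by
  refine le_of_tendsto (tendsto_alexandrovAngle γ₁ γ₂) ?_
  have hm : Ioc (0 : ℝ) 1 ×ˢ Ioc (0 : ℝ) 1 ∈ 𝓝[>] (0 : ℝ) ×ˢ 𝓝[>] (0 : ℝ) :=
    prod_mem_prod (Ioc_mem_nhdsGT one_pos) (Ioc_mem_nhdsGT one_pos)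
  filter_upwards [hm] with a ha
  exact comparisonAngle_mono γ₁ γ₂ ha.1.1 ha.1.2 le_rfl ha.2.1 ha.2.2 le_rfl

/-- The law of cosines inequality for the Alexandrov angle. -/
theorem law_of_cosines_le {p : X} (γ₁ γ₂ : GeodesicFrom p) (h₁ : γ₁ 1 ≠ p) (h₂ : γ₂ 1 ≠ p) :
    dist p (γ₁ 1) ^ 2 + dist p (γ₂ 1) ^ 2 - dist (γ₁ 1) (γ₂ 1) ^ 2 ≤
      2 * dist p (γ₁ 1) * dist p (γ₂ 1) * Real.cos (alexandrovAngle γ₁ γ₂) := by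
  have hcos : Real.cos (comparisonAngle p (γ₁ 1) (γ₂ 1)) ≤ Real.cos (alexandrovAngle γ₁ γ₂) :=
    Real.cos_le_cos_of_nonneg_of_le_pi (alexandrovAngle_mem _ _).1 (comparisonAngle_le_pi _ _ _)
      (alexandrovAngle_le_comparisonAngle _ _)
  have hpos : 0 ≤ 2 * dist p (γ₁ 1) * dist p (γ₂ 1) := by positivity
  have := mul_le_mul_of_nonneg_left hcos hpos
  rw [dist_sq_eq_comparisonAngle h₁ h₂]
  linarith

/-- Reshetnyak's quadrilateral inequality. -/
theorem dist_sq_add_dist_sq_le (x y z w : X) :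
    dist x w ^ 2 + dist y z ^ 2 ≤
      dist x z ^ 2 + dist y w ^ 2 + 2 * dist x y * dist z w := by
  rcases eq_or_ne x y with rfl | hxy
  · rw [dist_self]; linarith
  rcases eq_or_ne z w with rfl | hzw
  · rw [dist_self]; linarith
  have ha : 0 < dist x y := dist_pos.2 hxy
  have hb : 0 < dist z w := dist_pos.2 hzw
  obtain ⟨γ, hγ⟩ := exists_normalizedGeodesic x w
  set a := dist x y with hadef
  set b := dist z w with hbdef
  set s := a / (a + b) with hs
  have hs0 : 0 < s := by positivity
  have hs1 : 1 - s = b / (a + b) := by rw [hs]; field_simp; ring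
  have hs1' : 0 < 1 - s := by rw [hs1]; positivity
  have hy := cat0_vertex γ y (s := s) ⟨hs0.le, by linarith⟩
  have hz := cat0_vertex γ z (s := s) ⟨hs0.le, by linarith⟩
  rw [hγ, dist_comm w y, ← hadef] at hy
  rw [hγ, dist_comm w z, ← hbdef] at hz
  have htri : dist y z ≤ dist (γ s) y + dist (γ s) z := dist_triangle_left _ _ _
  set P := dist (γ s) y
  set Q := dist (γ s) z
  have hsq : dist y z ^ 2 ≤ (P + Q) ^ 2 := pow_le_pow_left₀ dist_nonneg htri 2
  have hcs : (P + Q) ^ 2 ≤ P ^ 2 / s + Q ^ 2 / (1 - s) := by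
    rw [div_add_div _ _ hs0.ne' hs1'.ne', le_div_iff₀ (by positivity)]
    nlinarith [sq_nonneg ((1 - s) * P - s * Q)]
  have hP : P ^ 2 / s ≤ (1 - s) / s * a ^ 2 + dist y w ^ 2 - (1 - s) * dist x w ^ 2 := by
    rw [div_le_iff₀ hs0]
    refine hy.trans (le_of_eq ?_)
    field_simp
  have hQ : Q ^ 2 / (1 - s) ≤ dist x z ^ 2 + s / (1 - s) * b ^ 2 - s * dist x w ^ 2 := by
    rw [div_le_iff₀ hs1']
    refine hz.trans (le_of_eq ?_)
    field_simp
  have e1 : (1 - s) / s * a ^ 2 = a * b := by rw [hs1, hs]; field_simp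
  have e2 : s / (1 - s) * b ^ 2 = a * b := by rw [hs1, hs]; field_simp
  rw [e1] at hP
  rw [e2] at hQ
  linarith

theorem alexandrovAngle_eq_zero_of_mem_geodesic {p : X} (γ δ : GeodesicFrom p) {s : ℝ}
    (hs0 : 0 < s) (hs1 : s ≤ 1) (hδ : δ 1 = γ s) : alexandrovAngle δ γ = 0 := by
  refine le_antisymm ((alexandrovAngle_le_comparisonAngle δ γ).trans (le_of_eq ?_))
    (alexandrovAngle_mem _ _).1
  rw [hδ]
  by_cases h : γ 1 = p
  · simp [comparisonAngle, h, (γ.eq_source_iff hs0 hs1).2 h]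
  have hD : 0 < dist p (γ 1) := dist_pos.2 (Ne.symm h)
  have h' : γ s ≠ p := fun e => h ((γ.eq_source_iff hs0 hs1).1 e)
  rw [comparisonAngle, if_neg h', if_neg h, γ.dist_source ⟨hs0.le, hs1⟩,
    γ.dist_eq ⟨hs0.le, hs1⟩ (by simp), Real.arccos_eq_zero, le_div_iff₀ (by positivity),
    mul_pow _ |s - 1|, sq_abs]
  apply le_of_eq
  ring

end Geometry

namespace TangentCone

variable {H : Type*} [MetricSpace H] [CAT0Space H] {p : H}

theorem zetaFrom_eq (γ : GeodesicFrom p) : zetaFrom γ = 0 ∨ zetaFrom γ = 1 :=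
  Direction.zeta_eq (Quotient.mk (directionSetoid p) γ)

theorem exists_mk (v : TangentCone p) : ∃ t γ, v = mk t γ := by
  obtain ⟨⟨t, δ⟩, rfl⟩ := Quotient.exists_rep v
  obtain ⟨γ, rfl⟩ := Quotient.exists_rep δ
  exact ⟨t, γ, rfl⟩

theorem distP_mk (t t' : ℝ≥0) (γ δ : GeodesicFrom p) :
    distP (mk t γ) (mk t' δ) = Real.sqrt ((t : ℝ) ^ 2 * zetaFrom γ + (t' : ℝ) ^ 2 * zetaFrom δ
      - 2 * t * t' * zetaFrom γ * zetaFrom δ * Real.cos (alexandrovAngle γ δ)) := rfl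

theorem norm_mk (t : ℝ≥0) (γ : GeodesicFrom p) : norm (mk t γ) = t * zetaFrom γ := by
  rw [norm, zero, distP_mk]
  rcases zetaFrom_eq γ with h | h <;> simp [h]

theorem g_mk (t t' : ℝ≥0) (γ δ : GeodesicFrom p) : g (mk t γ) (mk t' δ) =
    t * t' * zetaFrom γ * zetaFrom δ * Real.cos (alexandrovAngle γ δ) := by
  have h1 := Real.cos_le_one (alexandrovAngle γ δ)
  have ht : 0 ≤ (t : ℝ) * t' := by positivity
  rw [g, norm_mk, norm_mk, distP_mk, Real.sq_sqrt]
  · rcases zetaFrom_eq γ with h | h <;> rcases zetaFrom_eq δ with h' | h' <;> rw [h, h'] <;> ring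
  · rcases zetaFrom_eq γ with h | h <;> rcases zetaFrom_eq δ with h' | h' <;> rw [h, h'] <;>
      nlinarith [sq_nonneg ((t : ℝ) - t'), mul_le_mul_of_nonneg_left h1 ht]

theorem neg_norm_le_g_mk_one (v : TangentCone p) (δ : GeodesicFrom p) :
    -norm v ≤ g v (mk 1 δ) := by
  obtain ⟨t, γ, rfl⟩ := exists_mk v
  have h1 := Real.neg_one_le_cos (alexandrovAngle γ δ)
  rw [g_mk, norm_mk]
  have ht : 0 ≤ (t : ℝ) := t.2
  rcases zetaFrom_eq γ with h | h <;> rcases zetaFrom_eq δ with h' | h' <;> rw [h, h'] <;>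
    simp
  nlinarith

theorem zetaFrom_geodesic_of_ne {q : H} (h : p ≠ q) : zetaFrom (geodesic p q) = 1 := by
  rw [zetaFrom, geodesic_one, if_neg h.symm]

/-- Comparison of `g` with the quasilinearization of the distance. -/
theorem sq_le_g (s : ℝ≥0) (z x : H) {w : H} (hzw : z ≠ w) :
    s * (dist z x ^ 2 + dist z w ^ 2 - dist x w ^ 2) ≤
      2 * dist z w * g (mk (s * nndist z x) (geodesic z x)) (mk 1 (geodesic z w)) := by
  rw [g_mk, zetaFrom_geodesic_of_ne hzw]
  rcases eq_or_ne z x with rfl | hzx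
  · simp
  have h := law_of_cosines_le (geodesic z x) (geodesic z w) (by rw [geodesic_one]; exact hzx.symm)
    (by rw [geodesic_one]; exact hzw.symm)
  rw [geodesic_one, geodesic_one] at h
  rw [zetaFrom_geodesic_of_ne hzx]
  have := mul_le_mul_of_nonneg_left h s.2
  push_cast
  change (s : ℝ) * _ ≤ (s : ℝ) * _ at this
  linarith

theorem mk_eq_mk {t : ℝ≥0} {γ δ : GeodesicFrom p} (h : alexandrovAngle γ δ = 0) :
    mk t γ = mk t δ := by
  have : (Quotient.mk (directionSetoid p) γ) = Quotient.mk (directionSetoid p) δ :=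
    Quotient.sound h
  rw [mk, mk, this]

/-- Points of the segment from `z` to `x` span the same ray at `z` as `x` does. -/
theorem mk_geodesic_eq (z x : H) (a : ℝ≥0) {s : ℝ≥0} (hs0 : 0 < s) (hs1 : s ≤ 1) :
    mk (a / s * nndist z (geodesic z x s)) (geodesic z (geodesic z x s)) =
      mk (a * nndist z x) (geodesic z x) := by
  have e : nndist z (geodesic z x s) = nndist z x * s := by
    apply NNReal.coe_injective
    have := (geodesic z x).dist_source (s := s) ⟨s.2, by exact_mod_cast hs1⟩
    rw [geodesic_one] at this
    simpa using this
  have e' : a / s * nndist z (geodesic z x s) = a * nndist z x := by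
    rw [e]; field_simp
  rw [e']
  exact mk_eq_mk (alexandrovAngle_eq_zero_of_mem_geodesic _ _ (by exact_mod_cast hs0)
    (by exact_mod_cast hs1) (geodesic_one _ _))

end TangentCone

namespace VectorField

open TangentCone

variable {H : Type*} [MetricSpace H] [CAT0Space H] {A : VectorField H}

theorem mem_resolventSet {lam : ℝ≥0} (h : lam ≠ 0) {x z : H} :
    z ∈ A.resolventSet lam x ↔ mk (lam⁻¹ * nndist z x) (geodesic z x) ∈ A z := by
  rw [resolventSet, if_neg h, mem_ofPred_eq]

theorem IsMonotone.dist_le_of_mem_resolventSet (hA : A.IsMonotone) {lam : ℝ≥0} {x y z w : H}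
    (hz : z ∈ A.resolventSet lam x) (hw : w ∈ A.resolventSet lam y) : dist z w ≤ dist x y := by
  rcases eq_or_ne lam 0 with rfl | hlam
  · simp only [resolventSet, if_true, mem_singleton_iff] at hz hw
    rw [hz, hw]
  rcases eq_or_ne z w with rfl | hzw
  · simp
  rw [mem_resolventSet hlam] at hz hw
  have hm := hA z w _ hz _ hw
  have h1 := sq_le_g lam⁻¹ z x hzw
  have h2 := sq_le_g lam⁻¹ w y hzw.symm
  rw [dist_comm w z] at h2
  have hd : 0 < dist z w := dist_pos.2 hzw
  have h3 := mul_le_mul_of_nonneg_left hm (by positivity : 0 ≤ 2 * dist z w)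
  have hl : 0 < ((lam⁻¹ : ℝ≥0) : ℝ) := by
    exact_mod_cast inv_pos.2 (pos_iff_ne_zero.2 hlam)
  have h4 : dist z x ^ 2 + dist z w ^ 2 - dist x w ^ 2 +
      (dist w y ^ 2 + dist z w ^ 2 - dist y z ^ 2) ≤ 0 := by
    by_contra hcon
    push Not at hcon
    have := mul_pos hl hcon
    linarith
  have hq := dist_sq_add_dist_sq_le x y z w
  rw [dist_comm z x, dist_comm w y] at h4
  by_contra hcon
  push Not at hcon
  nlinarith

theorem SurjectivityCondition.resolvent_mem (hs : A.SurjectivityCondition) (lam : ℝ≥0) (x : H) :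
    A.resolvent lam x ∈ A.resolventSet lam x := by
  have hne : (A.resolventSet lam x).Nonempty := by
    rcases eq_or_ne lam 0 with rfl | hlam
    · exact ⟨x, by simp [resolventSet]⟩
    · obtain ⟨p, hp⟩ := hs lam⁻¹ (inv_pos.2 (pos_iff_ne_zero.2 hlam)) x
      exact ⟨p, (mem_resolventSet hlam).2 hp⟩
  rw [resolvent, dif_pos hne]
  exact hne.choose_spec

theorem eq_resolvent_of_mem (hA : A.IsMonotone) (hs : A.SurjectivityCondition) {lam : ℝ≥0}
    {x z : H} (hz : z ∈ A.resolventSet lam x) : z = A.resolvent lam x := by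
  have := hA.dist_le_of_mem_resolventSet hz (hs.resolvent_mem lam x)
  rw [dist_self] at this
  exact dist_le_zero.1 this

theorem resolventSet_eq_singleton (hA : A.IsMonotone) (hs : A.SurjectivityCondition) (lam : ℝ≥0)
    (x : H) : A.resolventSet lam x = {A.resolvent lam x} :=
  Subset.antisymm (fun _ hz => eq_resolvent_of_mem hA hs hz)
    (singleton_subset_iff.2 (hs.resolvent_mem lam x))

theorem dist_resolvent_le (hA : A.IsMonotone) (hs : A.SurjectivityCondition) (lam : ℝ≥0) (x y : H) :
    dist (A.resolvent lam x) (A.resolvent lam y) ≤ dist x y :=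
  hA.dist_le_of_mem_resolventSet (hs.resolvent_mem lam x) (hs.resolvent_mem lam y)

theorem dist_iterate_resolvent_le (hA : A.IsMonotone) (hs : A.SurjectivityCondition) (lam : ℝ≥0)
    (n : ℕ) (x y : H) :
    dist ((A.resolvent lam)^[n] x) ((A.resolvent lam)^[n] y) ≤ dist x y := by
  induction n with
  | zero => simp
  | succ n ih =>
    rw [Function.iterate_succ_apply', Function.iterate_succ_apply']
    exact (dist_resolvent_le hA hs _ _ _).trans ih

theorem resolvent_zero (hs : A.SurjectivityCondition) (x : H) : A.resolvent 0 x = x := by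
  have := hs.resolvent_mem 0 x
  simpa [resolventSet] using this

/-- The resolvent identity. -/
theorem resolvent_geodesic (hA : A.IsMonotone) (hs : A.SurjectivityCondition) {lam mu : ℝ≥0}
    (hmu : 0 < mu) (hle : mu ≤ lam) (x : H) :
    A.resolvent mu (geodesic (A.resolvent lam x) x ((mu / lam : ℝ≥0) : ℝ)) =
      A.resolvent lam x := by
  have hlam : 0 < lam := hmu.trans_le hle
  refine (eq_resolvent_of_mem hA hs ((mem_resolventSet hmu.ne').2 ?_)).symm
  have h := (mem_resolventSet hlam.ne').1 (hs.resolvent_mem lam x)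
  rw [← mk_geodesic_eq _ x lam⁻¹ (div_pos hmu hlam) ((div_le_one hlam).2 hle)] at h
  have e : lam⁻¹ / (mu / lam) = mu⁻¹ := by field_simp
  rwa [e] at h

theorem dist_resolvent_le_mul_norm (hA : A.IsMonotone) (hs : A.SurjectivityCondition) (lam : ℝ≥0)
    {x : H} {v : TangentCone x} (hv : v ∈ A x) :
    dist (A.resolvent lam x) x ≤ lam * norm v := by
  rcases eq_or_ne lam 0 with rfl | hlam
  · simp [resolvent_zero hs]
  have hz := (mem_resolventSet hlam).1 (hs.resolvent_mem lam x)
  rcases eq_or_ne (A.resolvent lam x) x with h | hne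
  · obtain ⟨t, γ, rfl⟩ := exists_mk v
    rw [h, dist_self, norm_mk]
    rcases zetaFrom_eq γ with h | h <;> rw [h] <;> positivity
  have hm := hA _ x _ hz v hv
  have hn := neg_norm_le_g_mk_one v (geodesic x (A.resolvent lam x))
  rw [g_mk, alexandrovAngle_self, Real.cos_zero, zetaFrom_geodesic_of_ne hne] at hm
  have hl : 0 < (lam : ℝ) := by exact_mod_cast pos_iff_ne_zero.2 hlam
  have h : (lam : ℝ)⁻¹ * dist (A.resolvent lam x) x ≤ norm v := by
    push_cast at hm
    linarith
  rwa [inv_mul_le_iff₀ hl] at h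

theorem absAt_ne_top {x : H} (hx : x ∈ A.dom) : A.absAt x ≠ ∞ := by
  obtain ⟨v, hv⟩ := hx
  exact ((iInf₂_le v hv).trans_lt ENNReal.ofReal_lt_top).ne

theorem dist_resolvent_le_mul_absAt (hA : A.IsMonotone) (hs : A.SurjectivityCondition) (lam : ℝ≥0)
    {x : H} (hx : x ∈ A.dom) :
    dist (A.resolvent lam x) x ≤ lam * (A.absAt x).toReal := by
  rcases eq_or_ne lam 0 with rfl | hlam
  · simp [resolvent_zero hs]
  have hl : 0 < (lam : ℝ) := by exact_mod_cast pos_iff_ne_zero.2 hlam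
  have h : ENNReal.ofReal ((lam : ℝ)⁻¹ * dist (A.resolvent lam x) x) ≤ A.absAt x := by
    refine le_iInf₂ fun v hv => ENNReal.ofReal_le_ofReal ?_
    rw [inv_mul_le_iff₀ hl]
    exact dist_resolvent_le_mul_norm hA hs lam hv
  rw [← inv_mul_le_iff₀ hl]
  exact (ENNReal.ofReal_le_iff_le_toReal (absAt_ne_top hx)).1 h

theorem dist_iterate_resolvent_self_le (hA : A.IsMonotone) (hs : A.SurjectivityCondition)
    (lam : ℝ≥0) {x : H} (hx : x ∈ A.dom) (n : ℕ) :
    dist ((A.resolvent lam)^[n] x) x ≤ n * lam * (A.absAt x).toReal := by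
  induction n with
  | zero => simp
  | succ n ih =>
    have h1 := dist_iterate_resolvent_le hA hs lam n (A.resolvent lam x) x
    have h2 := dist_resolvent_le_mul_absAt hA hs lam hx
    have h3 := dist_triangle ((A.resolvent lam)^[n + 1] x) ((A.resolvent lam)^[n] x) x
    rw [Function.iterate_succ_apply] at h3 ⊢
    push_cast
    linarith

/-- Comparison of two discrete approximations with step sizes `mu ≤ lam`. -/
theorem dist_iterate_iterate_sq_le (hA : A.IsMonotone) (hs : A.SurjectivityCondition)
    {lam mu : ℝ≥0} (hmu : 0 < mu) (hle : mu ≤ lam) {x : H} (hx : x ∈ A.dom) (m n : ℕ) :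
    dist ((A.resolvent mu)^[m] x) ((A.resolvent lam)^[n] x) ^ 2 ≤
      (A.absAt x).toReal ^ 2 *
        (((n : ℝ) * lam - m * mu) ^ 2 + m * mu * ((lam : ℝ) - mu)) := by
  have hlam : 0 < lam := hmu.trans_le hle
  have hl : 0 < (lam : ℝ) := by exact_mod_cast hlam
  have hle' : (mu : ℝ) ≤ lam := by exact_mod_cast hle
  induction m generalizing n with
  | zero =>
    have h := dist_iterate_resolvent_self_le hA hs lam hx n
    rw [dist_comm] at h
    refine (pow_le_pow_left₀ dist_nonneg h 2).trans (le_of_eq ?_)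
    push_cast
    ring
  | succ m ih =>
    cases n with
    | zero =>
      have h := dist_iterate_resolvent_self_le hA hs mu hx (m + 1)
      refine (pow_le_pow_left₀ dist_nonneg h 2).trans ?_
      have : 0 ≤ (A.absAt x).toReal ^ 2 * (((m + 1 : ℕ) : ℝ) * mu * ((lam : ℝ) - mu)) :=
        mul_nonneg (sq_nonneg _) (mul_nonneg (by positivity) (sub_nonneg.2 hle'))
      push_cast at this ⊢
      linarith
    | succ n =>
      set u := (A.resolvent mu)^[m] x with hu
      set y := (A.resolvent lam)^[n] x with hy
      have i1 := ih n
      rw [← hy] at i1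
      have i2 := ih (n + 1)
      rw [Function.iterate_succ_apply' _ n, ← hy] at i2
      rw [Function.iterate_succ_apply', Function.iterate_succ_apply', ← hu, ← hy,
        ← resolvent_geodesic hA hs hmu hle y]
      have h1 := dist_resolvent_le hA hs mu u
        (geodesic (A.resolvent lam y) y ((mu / lam : ℝ≥0) : ℝ))
      rw [dist_comm u] at h1
      refine (pow_le_pow_left₀ dist_nonneg h1 2).trans ?_
      have hα1 : (mu : ℝ) / lam ≤ 1 := (div_le_one hl).2 hle'
      have hα0 : 0 ≤ (mu : ℝ) / lam := by positivity
      have hv := cat0_vertex (geodesic (A.resolvent lam y) y) u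
        (s := ((mu / lam : ℝ≥0) : ℝ)) ⟨NNReal.coe_nonneg _, by push_cast; exact hα1⟩
      rw [geodesic_one, NNReal.coe_div] at hv
      rw [NNReal.coe_div]
      rw [dist_comm] at i1 i2
      have hαl : (mu : ℝ) / lam * lam = mu := div_mul_cancel₀ _ hl.ne'
      set α := (mu : ℝ) / lam
      have j1 := mul_le_mul_of_nonneg_left i1 hα0
      have j2 := mul_le_mul_of_nonneg_left i2 (sub_nonneg.2 hα1)
      have j3 : 0 ≤ α * (1 - α) * dist (A.resolvent lam y) y ^ 2 :=
        mul_nonneg (mul_nonneg hα0 (sub_nonneg.2 hα1)) (sq_nonneg _)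
      refine (hv.trans (sub_le_self _ j3)).trans ((add_le_add j2 j1).trans (le_of_eq ?_))
      rw [← hαl]
      push_cast
      ring

theorem dist_iterate_div_le (hA : A.IsMonotone) (hs : A.SurjectivityCondition) {x : H}
    (hx : x ∈ A.dom) (t : ℝ≥0) {k l : ℕ} (hk : 1 ≤ k) (hkl : k ≤ l) :
    dist ((A.resolvent (t / k))^[k] x) ((A.resolvent (t / l))^[l] x) ≤
      (A.absAt x).toReal * (t / Real.sqrt k) := by
  rcases eq_or_ne t 0 with rfl | ht
  · have : A.resolvent 0 = id := funext fun x => resolvent_zero hs x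
    simp [this]
  have hk' : (0 : ℝ) < k := by exact_mod_cast hk
  have hl' : (0 : ℝ) < l := by exact_mod_cast hk.trans hkl
  have hkn : (0 : ℝ≥0) < k := by exact_mod_cast hk
  have hln : (0 : ℝ≥0) < l := by exact_mod_cast hk.trans hkl
  have h := dist_iterate_iterate_sq_le hA hs (lam := t / k) (mu := t / l)
    (div_pos (pos_iff_ne_zero.2 ht) hln)
    (div_le_div_of_nonneg_left (zero_le) hkn (by exact_mod_cast hkl)) hx l k
  rw [dist_comm]
  refine (pow_le_pow_iff_left₀ dist_nonneg (by positivity) two_ne_zero).1 (h.trans ?_)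
  rw [mul_pow]
  refine mul_le_mul_of_nonneg_left ?_ (sq_nonneg _)
  rw [div_pow, Real.sq_sqrt hk'.le]
  push_cast
  rw [mul_div_cancel₀ _ hk'.ne', mul_div_cancel₀ _ hl'.ne']
  have : 0 ≤ (t : ℝ) * (t / l) := by positivity
  have e : (t : ℝ) ^ 2 / k = t * (t / k) := by ring
  rw [e]
  nlinarith

theorem dist_iterate_div_le_of_dist (hA : A.IsMonotone) (hs : A.SurjectivityCondition) {y : H}
    (hy : y ∈ A.dom) (x : H) (t : ℝ≥0) {k l : ℕ} (hk : 1 ≤ k) (hkl : k ≤ l) :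
    dist ((A.resolvent (t / k))^[k] x) ((A.resolvent (t / l))^[l] x) ≤
      2 * dist x y + (A.absAt y).toReal * (t / Real.sqrt k) := by
  have h1 := dist_iterate_resolvent_le hA hs (t / k) k x y
  have h2 := dist_iterate_resolvent_le hA hs (t / l) l y x
  have h3 := dist_iterate_div_le hA hs hy t hk hkl
  have h4 := dist_triangle4 ((A.resolvent (t / k))^[k] x) ((A.resolvent (t / k))^[k] y)
    ((A.resolvent (t / l))^[l] y) ((A.resolvent (t / l))^[l] x)
  rw [dist_comm y x] at h2
  linarith

theorem exists_dist_iterate_lt (hA : A.IsMonotone) (hs : A.SurjectivityCondition) {x : H}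
    (hx : x ∈ closure A.dom) (T : ℝ≥0) {ε : ℝ} (hε : 0 < ε) :
    ∃ N : ℕ, ∀ t ≤ T, ∀ k ≥ N, ∀ l ≥ k,
      dist ((A.resolvent (t / k))^[k] x) ((A.resolvent (t / l))^[l] x) ≤ ε := by
  obtain ⟨y, hy, hxy⟩ := Metric.mem_closure_iff.1 hx (ε / 4) (by positivity)
  have hlim : Tendsto (fun k : ℕ => (A.absAt y).toReal * ((T : ℝ) / Real.sqrt k)) atTop (𝓝 0) := by
    have h : Tendsto (fun k : ℕ => (T : ℝ) / Real.sqrt k) atTop (𝓝 0) :=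
      (Real.tendsto_sqrt_atTop.comp tendsto_natCast_atTop_atTop).const_div_atTop _
    simpa using h.const_mul (A.absAt y).toReal
  obtain ⟨N, hN⟩ := eventually_atTop.1 (hlim.eventually_lt_const (half_pos hε))
  refine ⟨max N 1, fun t ht k hk l hkl => ?_⟩
  have h1 := dist_iterate_div_le_of_dist hA hs hy x t ((le_max_right N 1).trans hk) hkl
  have h2 := hN k ((le_max_left N 1).trans hk)
  have h3 : (A.absAt y).toReal * ((t : ℝ) / Real.sqrt k) ≤
      (A.absAt y).toReal * ((T : ℝ) / Real.sqrt k) := by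
    have : (t : ℝ) ≤ T := by exact_mod_cast ht
    gcongr
  linarith

theorem exists_tendsto_iterate [CompleteSpace H] (hA : A.IsMonotone)
    (hs : A.SurjectivityCondition) {x : H} (hx : x ∈ closure A.dom) (t : ℝ≥0) :
    ∃ y, Tendsto (fun k : ℕ => (A.resolvent (t / k))^[k] x) atTop (𝓝 y) := by
  apply cauchySeq_tendsto_of_complete
  refine Metric.cauchySeq_iff'.2 fun ε hε => ?_
  obtain ⟨N, hN⟩ := exists_dist_iterate_lt hA hs hx t (half_pos hε)
  refine ⟨N, fun n hn => ?_⟩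
  rw [dist_comm]
  exact (hN t le_rfl N le_rfl n hn).trans_lt (half_lt_self hε)

end VectorField

end CAT0

open CAT0
theorem theorem5p2 {H : Type*} [MetricSpace H] [CAT0Space H] [CompleteSpace H]
    (hH : GeodesicExtensionProperty H) (A : VectorField H) (hmono : A.IsMonotone)
    (hsurj : A.SurjectivityCondition) :
    (∀ (lam : ℝ≥0) (x : H), A.resolventSet lam x = {A.resolvent lam x}) ∧
    ∃ S : ℝ≥0 → H → H,
      (∀ x ∈ closure A.dom,
        (∀ t : ℝ≥0, Tendsto (fun k : ℕ => (A.resolvent (t / k))^[k] x) atTop (𝓝 (S t x))) ∧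
        ∀ I : Set ℝ≥0, Bornology.IsBounded I →
          TendstoUniformlyOn (fun (k : ℕ) (t : ℝ≥0) => (A.resolvent (t / k))^[k] x)
            (fun t => S t x) atTop I) ∧
      ∀ x ∈ A.dom, ∀ (t : ℝ≥0) (k : ℕ), 1 ≤ k →
        edist ((A.resolvent (t / k))^[k] x) (S t x) ≤
          A.absAt x * ENNReal.ofReal (2 * t / Real.sqrt k) := by
  refine ⟨VectorField.resolventSet_eq_singleton hmono hsurj, ?_⟩
  have hS : ∀ (t : ℝ≥0) (x : H), ∃ y, x ∈ closure A.dom →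
      Tendsto (fun k : ℕ => (A.resolvent (t / k))^[k] x) atTop (𝓝 y) := by
    intro t x
    by_cases hx : x ∈ closure A.dom
    · obtain ⟨y, hy⟩ := VectorField.exists_tendsto_iterate hmono hsurj hx t
      exact ⟨y, fun _ => hy⟩
    · exact ⟨x, fun h => absurd h hx⟩
  choose S hS using hS
  refine ⟨S, fun x hx => ⟨fun t => hS t x hx, fun I hI => ?_⟩, fun x hx t k hk => ?_⟩
  · obtain ⟨T, hT⟩ := hI.bddAbove
    refine Metric.tendstoUniformlyOn_iff.2 fun ε hε => ?_
    obtain ⟨N, hN⟩ := VectorField.exists_dist_iterate_lt hmono hsurj hx T (half_pos hε)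
    filter_upwards [eventually_ge_atTop N] with k hk t ht
    rw [dist_comm]
    refine lt_of_le_of_lt ?_ (half_lt_self hε)
    refine le_of_tendsto (tendsto_const_nhds.dist (hS t x hx)) ?_
    filter_upwards [eventually_ge_atTop k] with l hl
    exact hN t (hT ht) k hk l hl
  · have h : dist ((A.resolvent (t / k))^[k] x) (S t x) ≤
        (A.absAt x).toReal * (t / Real.sqrt k) := by
      refine le_of_tendsto (tendsto_const_nhds.dist (hS t x (subset_closure hx))) ?_
      filter_upwards [eventually_ge_atTop k] with l hl
      exact VectorField.dist_iterate_div_le hmono hsurj hx t hk hl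
    rw [edist_dist, ← ENNReal.ofReal_toReal (VectorField.absAt_ne_top hx),
      ← ENNReal.ofReal_mul ENNReal.toReal_nonneg]
    refine ENNReal.ofReal_le_ofReal (h.trans ?_)
    gcongr
    linarith [t.2]
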